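/- **Lemma (Milnor).** Let $n\ge 2$, $q\ge 1$ and $\rho\in\pi_{n-1}(SO(q))$. Let $\xi$ be the oriented real vector bundle of rank $q$ over $S^n$ corresponding to $\rho$, i.e. (up to isomorphism) the bundle obtained by gluing the trivial bundles with fibre $\mathbb{R}^q$ over the two hemispheres of $S^n$ along the equator $S^{n-1}$ by a map $S^{n-1}\to SO(q)$ representing $\rho$. Let $Th(\xi)$ be its Thom space, i.e. the one-point compactification of the total space, pointed by the added point. Write $S^q=\mathbb{R}^q\cup\{\infty\}\cong D^q/S^{q-1}$, and let $J:\pi_{n-1}(SO(q))\to\pi_{n+q-1}(S^q)$ be the $J$-homomorphism: $J[f]$ is represented by the map $$S^{n+q-1}\cong (D^n\times S^{q-1})\cup (S^{n-1}\times D^q)\to S^q,\qquad D^n\times S^{q-1}\mapsto\infty,\quad (x,w)\mapsto f(x)[w]\ \text{ for } (x,w)\in S^{n-1}\times D^q .$$ Then $Th(\xi)$ has a cell structure $D^{n+q}\cup_\Phi S^q$ whose attaching map represents $J(\rho)$: there are a pointed map $\Phi:S^{n+q-1}\to S^q$ with $[\Phi]=J(\rho)\in\pi_{n+q-1}(S^q)$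 and a base point preserving homeomorphism $Th(\xi)\cong D^{n+q}\cup_\Phi S^q$, where $D^{n+q}\cup_\Phi S^q$ is the space obtained from $S^q$ by attaching an $(n+q)$-cell along $\Phi$. -/

import Mathlib

open Topology Bundle

noncomputable section

namespace ThomJ

/-! ### Euclidean spaces, spheres, rotation groups -/

/-- Euclidean `k`-space `ℝ^k`. -/
abbrev Euc (k : ℕ) : Type := EuclideanSpace ℝ (Fin k)

/-- The unit sphere of `ℝ^k`, that is, the sphere `S^(k-1)`. -/
abbrev USphere (k : ℕ) : Type := Metric.sphere (0 : Euc k) 1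

/-- The closed unit ball `D^k` of `ℝ^k`. -/
abbrev UBall (k : ℕ) : Type := Metric.closedBall (0 : Euc k) 1

/-- The rotation group `SO(q)`, with the topology of a subspace of the `q × q` matrices. -/
abbrev SO (q : ℕ) : Type := Matrix.specialOrthogonalGroup (Fin q) ℝ

/-- The sphere `S^q = ℝ^q ∪ {∞}`. -/
abbrev Sph (q : ℕ) : Type := OnePoint (Euc q)

/-- The standard linear action of `SO(q)` on `ℝ^q`. -/
def act {q : ℕ} (A : SO q) : Euc q →L[ℝ] Euc q :=
  Matrix.toEuclideanCLM (n := Fin q) (𝕜 := ℝ) (A : Matrix (Fin q) (Fin q) ℝ)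

/-- The projection `ℝ^(n+m) = ℝ^n × ℝ^m → ℝ^n`. -/
def fstPart {n m : ℕ} (z : Euc (n + m)) : Euc n :=
  WithLp.toLp 2 fun i => z (Fin.castAdd m i)

/-- The projection `ℝ^(n+m) = ℝ^n × ℝ^m → ℝ^m`. -/
def sndPart {n m : ℕ} (z : Euc (n + m)) : Euc m :=
  WithLp.toLp 2 fun i => z (Fin.natAdd n i)

/-- The direction `x / ‖x‖` of a nonzero vector. -/
def direction {k : ℕ} (x : Euc k) (hx : x ≠ 0) : USphere k :=
  ⟨‖x‖⁻¹ • x, by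
    rw [mem_sphere_zero_iff_norm, norm_smul, norm_inv, norm_norm,
      inv_mul_cancel₀ (norm_ne_zero_iff.mpr hx)]⟩

/-- The inclusion `S^(m-1) → S^(n+m-1)`, `y ↦ (0, y)`. -/
def inclSnd (n : ℕ) {m : ℕ} (y : USphere m) : USphere (n + m) :=
  ⟨WithLp.toLp 2 (Fin.append (0 : Fin n → ℝ) (y : Euc m)), by
    refine mem_sphere_zero_iff_norm.mpr (Eq.trans ?_ (mem_sphere_zero_iff_norm.mp y.2))
    rw [EuclideanSpace.norm_eq, EuclideanSpace.norm_eq]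
    simp [Fin.sum_univ_add]⟩

/-! ### Pointed maps and their homotopy classes -/

/-- Continuous maps `X → Y` that send the base point `x₀` to the base point `y₀`. -/
def PMap {X Y : Type*} [TopologicalSpace X] [TopologicalSpace Y] (x₀ : X) (y₀ : Y) : Type _ :=
  {f : C(X, Y) // f x₀ = y₀}

/-- Homotopy through base point preserving maps. -/
def pSetoid {X Y : Type*} [TopologicalSpace X] [TopologicalSpace Y] (x₀ : X) (y₀ : Y) :
    Setoid (PMap x₀ y₀) where
  r f g := ContinuousMap.HomotopicRel f.1 g.1 {x₀}
  iseqv :=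
    ⟨fun f => .refl f.1, fun h => ContinuousMap.HomotopicRel.symm h,
      fun h k => ContinuousMap.HomotopicRel.trans h k⟩

/-- The set `[X, Y]` of pointed homotopy classes of pointed maps.  For `X` the unit sphere of
`ℝ^(k+1)` this is (the underlying set of) the homotopy group `π_k(Y, y₀)`. -/
def PClass {X Y : Type*} [TopologicalSpace X] [TopologicalSpace Y] (x₀ : X) (y₀ : Y) : Type _ :=
  Quotient (pSetoid x₀ y₀)

/-- The class of a pointed map. -/
def PMap.cls {X Y : Type*} [TopologicalSpace X] [TopologicalSpace Y] {x₀ : X} {y₀ : Y}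
    (f : PMap x₀ y₀) : PClass x₀ y₀ :=
  Quotient.mk (pSetoid x₀ y₀) f

/-! ### Elementary facts -/

theorem continuous_fstPart {n m : ℕ} : Continuous (fstPart : Euc (n + m) → Euc n) := by
  unfold fstPart; fun_prop

theorem continuous_sndPart {n m : ℕ} : Continuous (sndPart : Euc (n + m) → Euc m) := by
  unfold sndPart; fun_prop

theorem norm_sq_parts {n m : ℕ} (z : Euc (n + m)) :
    ‖fstPart z‖ ^ 2 + ‖sndPart z‖ ^ 2 = ‖z‖ ^ 2 := by
  simp [EuclideanSpace.norm_sq_eq, fstPart, sndPart, Fin.sum_univ_add]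

theorem continuous_act {q : ℕ} : Continuous (act : SO q → Euc q →L[ℝ] Euc q) := by
  have h : Continuous
      ((Matrix.toEuclideanCLM (n := Fin q) (𝕜 := ℝ)).toAlgEquiv.toLinearMap) :=
    LinearMap.continuous_of_finiteDimensional _
  exact h.comp continuous_subtype_val

theorem act_one {q : ℕ} : act (1 : SO q) = ContinuousLinearMap.id ℝ (Euc q) :=
  map_one (Matrix.toEuclideanCLM (n := Fin q) (𝕜 := ℝ))

theorem act_mul {q : ℕ} (A B : SO q) : act (A * B) = (act A).comp (act B) :=
  map_mul (Matrix.toEuclideanCLM (n := Fin q) (𝕜 := ℝ)) _ _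

theorem norm_act {q : ℕ} (A : SO q) (v : Euc q) : ‖act A v‖ = ‖v‖ := by
  have hA : star (A : Matrix (Fin q) (Fin q) ℝ) * (A : Matrix (Fin q) (Fin q) ℝ) = 1 :=
    (Matrix.mem_orthogonalGroup_iff' (Fin q) ℝ).mp
      (Matrix.mem_specialOrthogonalGroup_iff.mp A.2).1
  have h1 : (ContinuousLinearMap.adjoint (act A)).comp (act A)
      = ContinuousLinearMap.id ℝ (Euc q) := by
    have := congrArg (Matrix.toEuclideanCLM (n := Fin q) (𝕜 := ℝ)) hA
    rw [map_mul, map_star, map_one] at this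
    exact this
  have h2 := ContinuousLinearMap.apply_norm_sq_eq_inner_adjoint_left (act A) v
  rw [h1] at h2
  have h3 : ‖act A v‖ ^ 2 = ‖v‖ ^ 2 := by
    rw [h2]; simp
  exact (sq_eq_sq₀ (norm_nonneg _) (norm_nonneg _)).mp h3

/-! ### The J-homomorphism -/

/-- The map underlying the Hopf construction.  The sphere `S^(n+q-1)` is identified radially with
`∂(D^n × D^q) = (D^n × S^(q-1)) ∪ (S^(n-1) × D^q)`, the join of `S^(n-1)` and `S^(q-1)`.
The part `D^n × S^(q-1)` is sent to `∞`, and `(x, w) ∈ S^(n-1) × D^q` is sent to `f x` applied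
to the image of `w` in `D^q / S^(q-1) ≅ ℝ^q ∪ {∞}`, the identification being
`w ↦ w / (1 - ‖w‖)`. In terms of `z = (u, v)` one has `x = u / ‖u‖` and `w = v / ‖u‖` in the
second part, which is where `‖v‖ ≤ ‖u‖`, hence `w / (1 - ‖w‖) = v / (‖u‖ - ‖v‖)`. -/
def hopfFun {n q : ℕ} (f : USphere n → SO q) (z : USphere (n + q)) : Sph q :=
  open Classical in
  if h : ‖sndPart z.1‖ < ‖fstPart z.1‖ then
    ((act (f (direction (fstPart z.1) (norm_pos_iff.mp ((norm_nonneg _).trans_lt h))))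
      ((‖fstPart z.1‖ - ‖sndPart z.1‖)⁻¹ • sndPart z.1) : Euc q) : OnePoint (Euc q))
  else OnePoint.infty

theorem continuous_hopfFun {T : Type*} [TopologicalSpace T] {n q : ℕ}
    (F : T × USphere n → SO q) (hF : Continuous F) :
    Continuous fun p : T × USphere (n + q) => hopfFun (fun x => F (p.1, x)) p.2 := by
  classical
  set a : T × USphere (n + q) → Euc n := fun p => fstPart p.2.1 with ha
  set b : T × USphere (n + q) → Euc q := fun p => sndPart p.2.1 with hb
  have hac : Continuous a := continuous_fstPart.comp (continuous_subtype_val.comp continuous_snd)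
  have hbc : Continuous b := continuous_sndPart.comp (continuous_subtype_val.comp continuous_snd)
  have hU : IsOpen {p | ‖b p‖ < ‖a p‖} := isOpen_lt hbc.norm hac.norm
  rw [continuous_iff_continuousAt]
  intro p
  by_cases hp : ‖b p‖ < ‖a p‖
  · -- the open part
    have hon : ContinuousOn
        (fun p : T × USphere (n + q) => hopfFun (fun x => F (p.1, x)) p.2)
        {p | ‖b p‖ < ‖a p‖} := by
      rw [continuousOn_iff_continuous_domRestrict]
      have hne : ∀ r : {p | ‖b p‖ < ‖a p‖}, a r.1 ≠ 0 := fun r =>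
        norm_pos_iff.mp ((norm_nonneg _).trans_lt r.2)
      have hd : Continuous fun r : {p | ‖b p‖ < ‖a p‖} => direction (a r.1) (hne r) := by
        refine Continuous.subtype_mk ?_ _
        exact ((hac.comp continuous_subtype_val).norm.inv₀
          (fun r => norm_ne_zero_iff.mpr (hne r))).smul (hac.comp continuous_subtype_val)
      have hA : Continuous fun r : {p | ‖b p‖ < ‖a p‖} =>
          act (F (r.1.1, direction (a r.1) (hne r))) :=
        continuous_act.comp
          (hF.comp ((continuous_fst.comp continuous_subtype_val).prodMk hd))
      have hs : Continuous fun r : {p | ‖b p‖ < ‖a p‖} =>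
          (‖a r.1‖ - ‖b r.1‖)⁻¹ • b r.1 := by
        have hpos : ∀ r : {p | ‖b p‖ < ‖a p‖}, ‖a r.1‖ - ‖b r.1‖ ≠ 0 := fun r => by
          have hr : ‖b r.1‖ < ‖a r.1‖ := r.2
          exact (sub_pos.mpr hr).ne'
        exact (((hac.comp continuous_subtype_val).norm.sub
          (hbc.comp continuous_subtype_val).norm).inv₀ hpos).smul
            (hbc.comp continuous_subtype_val)
      refine (OnePoint.continuous_coe.comp (hA.clm_apply hs)).congr ?_
      intro r
      have hr : ‖sndPart r.1.2.1‖ < ‖fstPart r.1.2.1‖ := r.2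
      simp only [Set.domRestrict_apply, hopfFun, dif_pos hr, Function.comp_apply]
      rfl
    exact hon.continuousAt (hU.mem_nhds hp)
  · -- near a point that is sent to infinity
    have hval : hopfFun (fun x => F (p.1, x)) p.2 = OnePoint.infty := dif_neg hp
    have hbp : 0 < ‖b p‖ := by
      rcases (norm_nonneg (b p)).eq_or_lt with h0 | h0
      · exfalso
        have h1 : ‖a p‖ = 0 := le_antisymm (by linarith) (norm_nonneg _)
        have h2 := norm_sq_parts (p.2.1 : Euc (n + q))
        have h3 : ‖(p.2.1 : Euc (n + q))‖ = 1 := mem_sphere_zero_iff_norm.mp p.2.2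
        have h4 : ‖fstPart (p.2.1 : Euc (n + q))‖ = 0 := h1
        have h5 : ‖sndPart (p.2.1 : Euc (n + q))‖ = 0 := h0.symm
        rw [h3, h4, h5] at h2
        norm_num at h2
      · exact h0
    unfold ContinuousAt
    simp only [hval]
    rw [OnePoint.hasBasis_nhds_infty.tendsto_right_iff]
    rintro K ⟨-, hK⟩
    obtain ⟨M, hM⟩ := hK.isBounded.exists_norm_le
    have hV : IsOpen {r | M * (‖a r‖ - ‖b r‖) < ‖b r‖} :=
      isOpen_lt (continuous_const.mul (hac.norm.sub hbc.norm)) hbc.norm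
    by_cases hM0 : M < 0
    · have hKe : K = ∅ := by
        ext y
        simp only [Set.mem_empty_iff_false, iff_false]
        intro hy
        exact absurd ((norm_nonneg y).trans (hM y hy)) (not_le.mpr hM0)
      refine Filter.Eventually.of_forall fun r => ?_
      subst hKe
      by_cases hr : hopfFun (fun x => F (r.1, x)) r.2 = OnePoint.infty
      · exact Or.inr hr
      · obtain ⟨y, hy⟩ := OnePoint.ne_infty_iff_exists.mp hr
        exact Or.inl ⟨y, by simp, hy⟩
    · have hpV : M * (‖a p‖ - ‖b p‖) < ‖b p‖ :=
        (mul_nonpos_of_nonneg_of_nonpos (not_lt.mp hM0) (by linarith)).trans_lt hbp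
      filter_upwards [hV.mem_nhds hpV] with r hr
      by_cases hr' : ‖b r‖ < ‖a r‖
      · have hr'' : ‖sndPart (r.2.1 : Euc (n + q))‖ < ‖fstPart (r.2.1 : Euc (n + q))‖ := hr'
        rw [Set.mem_union]
        unfold hopfFun
        rw [dif_pos hr'']
        refine Or.inl ⟨_, ?_, rfl⟩
        intro hmem
        have h6 := hM _ hmem
        rw [norm_act, norm_smul, norm_inv, Real.norm_of_nonneg (sub_pos.mpr hr').le,
          inv_mul_le_iff₀ (sub_pos.mpr hr')] at h6
        have h7 : M * (‖a r‖ - ‖b r‖) < ‖b r‖ := hr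
        have h8 : ‖b r‖ ≤ (‖a r‖ - ‖b r‖) * M := h6
        linarith [mul_comm M (‖a r‖ - ‖b r‖)]
      · exact Or.inr (dif_neg hr')

theorem hopfFun_inclSnd {n q : ℕ} (f : USphere n → SO q) (y : USphere q) :
    hopfFun f (inclSnd n y) = OnePoint.infty := by
  have h : fstPart (inclSnd n y).1 = 0 := by
    ext i; simp [fstPart, inclSnd]
  unfold hopfFun
  rw [dif_neg]
  rw [h, norm_zero]
  exact not_lt.mpr (norm_nonneg _)

theorem continuous_hopfFun_single {n q : ℕ} (f : C(USphere n, SO q)) :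
    Continuous (hopfFun (f : USphere n → SO q)) := by
  have hF : Continuous (fun p : Unit × USphere n => f p.2) := by fun_prop
  have h := continuous_hopfFun (n := n) (q := q) (fun p : Unit × USphere n => f p.2) hF
  have hi : Continuous fun z : USphere (n + q) => ((), z) := by fun_prop
  exact Continuous.comp (f := fun z : USphere (n + q) => ((), z))
    (g := fun p : Unit × USphere (n + q) => hopfFun (fun x => f x) p.2) h hi

/-- The Hopf construction on a pointed map `S^(n-1) → SO(q)`; the base point of `S^(n+q-1)` lies
in `0 × S^(q-1)` and that of `S^q` is `∞`. -/
def hopfMap {n q : ℕ} {x₀ : USphere n} (y₀ : USphere q) (f : PMap x₀ (1 : SO q)) :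
    PMap (inclSnd n y₀) (OnePoint.infty : Sph q) :=
  ⟨⟨hopfFun f.1, continuous_hopfFun_single f.1⟩,
    hopfFun_inclSnd f.1 y₀⟩

theorem hopfMap_homotopic {n q : ℕ} {x₀ : USphere n} (y₀ : USphere q) (f g : PMap x₀ (1 : SO q))
    (h : ContinuousMap.HomotopicRel f.1 g.1 {x₀}) :
    (hopfMap y₀ f).cls = (hopfMap y₀ g).cls := by
  obtain ⟨H⟩ := h
  have hc := continuous_hopfFun (n := n) (q := q) (fun p : unitInterval × USphere n => H p)
    H.continuous
  refine Quotient.sound (s := pSetoid (inclSnd n y₀) (OnePoint.infty : Sph q))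
    ⟨⟨⟨⟨fun p : unitInterval × USphere (n + q) => hopfFun (fun x => H (p.1, x)) p.2, hc⟩,
      fun z => ?_, fun z => ?_⟩, ?_⟩⟩
  · change hopfFun (fun x => H (0, x)) z = hopfFun f.1 z
    congr 1; ext1 x; exact H.map_zero_left x
  · change hopfFun (fun x => H (1, x)) z = hopfFun g.1 z
    congr 1; ext1 x; exact H.map_one_left x
  · rintro t z rfl
    exact (hopfFun_inclSnd (fun x => H (t, x)) y₀).trans (hopfFun_inclSnd f.1 y₀).symm

/-- The J-homomorphism `J : π_{n-1}(SO(q)) → π_{n+q-1}(S^q)`. -/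
def J {n q : ℕ} {x₀ : USphere n} (y₀ : USphere q) :
    PClass x₀ (1 : SO q) → PClass (inclSnd n y₀) (OnePoint.infty : Sph q) :=
  Quotient.lift (fun f => (hopfMap y₀ f).cls) fun f g h => hopfMap_homotopic y₀ f g h

/-! ### The vector bundle over `S^n` with a given clutching map -/

/-- The height of a point of `S^n ⊆ ℝ^n × ℝ`. -/
def height {n : ℕ} (s : USphere (n + 1)) : ℝ := s.1 (Fin.last n)

theorem continuous_height {n : ℕ} : Continuous (height : USphere (n + 1) → ℝ) := by
  unfold height; fun_prop

theorem fstPart_ne_zero {n : ℕ} (s : USphere (n + 1)) (h₁ : height s ≠ -1) (h₂ : height s ≠ 1) :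
    (fstPart s.1 : Euc n) ≠ 0 := by
  intro h
  have h3 := norm_sq_parts (n := n) (m := 1) s.1
  have h4 : ‖(s.1 : Euc (n + 1))‖ = 1 := mem_sphere_zero_iff_norm.mp s.2
  have h5 : ‖(sndPart s.1 : Euc 1)‖ ^ 2 = height s ^ 2 := by
    simp [EuclideanSpace.norm_sq_eq, sndPart, height]
    rfl
  rw [h, h4, h5, norm_zero] at h3
  have h6 : (height s + 1) * (height s - 1) = 0 := by linarith
  rcases mul_eq_zero.mp h6 with h7 | h7
  · exact h₁ (by linarith)
  · exact h₂ (by linarith)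

/-- The clutching map `f : S^(n-1) → SO(q)`, extended from the equator to the complement of the
two poles of `S^n` along the meridians (with a junk value at the poles). -/
def meridian {n q : ℕ} (f : USphere n → SO q) (s : USphere (n + 1)) : SO q :=
  open Classical in
  if h : (fstPart s.1 : Euc n) ≠ 0 then f (direction (fstPart s.1) h) else 1

theorem continuousOn_meridian {n q : ℕ} (f : C(USphere n, SO q)) :
    ContinuousOn (meridian (f : USphere n → SO q)) {s | (fstPart s.1 : Euc n) ≠ 0} := by
  rw [continuousOn_iff_continuous_domRestrict]
  have hc : Continuous fun r : {s : USphere (n + 1) | (fstPart s.1 : Euc n) ≠ 0} =>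
      (fstPart r.1.1 : Euc n) :=
    continuous_fstPart.comp (continuous_subtype_val.comp continuous_subtype_val)
  have hd : Continuous fun r : {s : USphere (n + 1) | (fstPart s.1 : Euc n) ≠ 0} =>
      direction (fstPart r.1.1 : Euc n) r.2 :=
    Continuous.subtype_mk
      ((hc.norm.inv₀ fun r => norm_ne_zero_iff.mpr r.2).smul hc) _
  refine (f.continuous.comp hd).congr fun r => ?_
  have hr : (fstPart r.1.1 : Euc n) ≠ 0 := r.2
  simp only [Set.domRestrict_apply, meridian, dif_pos hr, Function.comp_apply]

/-- The two charts of the clutched bundle: `true` stands for the complement of the south pole,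
`false` for the complement of the north pole. -/
def chartSet (n : ℕ) : Bool → Set (USphere (n + 1))
  | true => {s | height s ≠ -1}
  | false => {s | height s ≠ 1}

/-- The rotation that changes coordinates: `f` itself from the northern to the southern chart. -/
def transition {n q : ℕ} (f : USphere n → SO q) : Bool → Bool → USphere (n + 1) → SO q
  | true, false => meridian f
  | false, true => fun s => (meridian f s)⁻¹
  | _, _ => fun _ => 1

/-- The rank `q` vector bundle over `S^n` obtained by clutching: the trivial bundles with fibre
`ℝ^q` over the two hemispheres (thickened to the complements of the poles) are glued by the
rotations `f`, so that its structure group is `SO(q)` and it is oriented. -/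
def clutch {n q : ℕ} (f : C(USphere n, SO q)) :
    VectorBundleCore ℝ (USphere (n + 1)) (Euc q) Bool where
  baseSet := chartSet n
  isOpen_baseSet i := by
    cases i
    · exact isOpen_ne_fun continuous_height continuous_const
    · exact isOpen_ne_fun continuous_height continuous_const
  indexAt s := open Classical in if height s ≠ -1 then true else false
  mem_baseSet_at s := by
    by_cases h : height s = -1
    · simp [h, chartSet]
      norm_num
    · simp [h, chartSet]
  coordChange i j s := act (transition f i j s)
  coordChange_self i s _ v := by cases i <;> simp [transition, act_one]
  continuousOn_coordChange i j := by
    have hm : ContinuousOn (meridian (f : USphere n → SO q))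
        {s | height s ≠ -1 ∧ height s ≠ 1} :=
      (continuousOn_meridian f).mono fun s hs => fstPart_ne_zero s hs.1 hs.2
    have hinv : Continuous (fun A : SO q => A⁻¹) := by
      refine Continuous.subtype_mk ?_ _
      exact continuous_star.comp continuous_subtype_val
    refine continuous_act.comp_continuousOn ?_
    cases i <;> cases j
    · exact continuousOn_const
    · exact hinv.comp_continuousOn (hm.mono fun s hs => ⟨hs.2, hs.1⟩)
    · exact hm.mono fun s hs => ⟨hs.1, hs.2⟩
    · exact continuousOn_const
  coordChange_comp i j k s _ v := by
    rw [← ContinuousLinearMap.comp_apply, ← act_mul]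
    cases i <;> cases j <;> cases k <;> simp [transition]

/-- An isomorphism of real vector bundles with the same base: a family of linear isomorphisms of
the fibres whose union is a homeomorphism of the total spaces. -/
structure BundleIso {B F F' : Type*} (E : B → Type*) (E' : B → Type*)
    [∀ x, AddCommGroup (E x)] [∀ x, Module ℝ (E x)]
    [∀ x, AddCommGroup (E' x)] [∀ x, Module ℝ (E' x)]
    [TopologicalSpace (TotalSpace F E)] [TopologicalSpace (TotalSpace F' E')] where
  fibre : ∀ x, E x ≃ₗ[ℝ] E' x
  total : TotalSpace F E ≃ₜ TotalSpace F' E'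
  total_apply : ∀ p : TotalSpace F E, total p = ⟨p.proj, fibre p.proj p.snd⟩

/-- The vector bundle `ξ` over `S^n` corresponds to the class `ρ ∈ π_{n-1}(SO(q))`: it is
isomorphic to the bundle obtained by clutching with a representative of `ρ`. -/
def Corresponds {n q : ℕ} {x₀ : USphere n} (ρ : PClass x₀ (1 : SO q))
    (ξ : USphere (n + 1) → Type*) [∀ s, AddCommGroup (ξ s)] [∀ s, Module ℝ (ξ s)]
    [TopologicalSpace (TotalSpace (Euc q) ξ)] : Prop :=
  ∃ f : PMap x₀ (1 : SO q), f.cls = ρ ∧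
    Nonempty (BundleIso (F := Euc q) (F' := Euc q) ξ (clutch f.1).Fiber)

/-! ### Thom spaces and attaching a cell -/

/-- The Thom space of a vector bundle over a compact base: the one-point compactification of its
total space, with base point `∞`. -/
abbrev Thom {B : Type*} (F : Type*) (ξ : B → Type*) [TopologicalSpace (TotalSpace F ξ)] : Type _ :=
  OnePoint (TotalSpace F ξ)

/-- The gluing relation on `D^k ⊔ Y` for an attaching map `Φ : S^(k-1) → Y`: each point of
`∂D^k = S^(k-1)` is glued to its image. -/
inductive GlueRel {k : ℕ} {Y : Type*} (Φ : USphere k → Y) : UBall k ⊕ Y → UBall k ⊕ Y → Prop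
  | glue (z : USphere k) :
      GlueRel Φ (Sum.inl ⟨z.1, Metric.sphere_subset_closedBall z.2⟩) (Sum.inr (Φ z))

/-- The space `D^k ∪_Φ Y` obtained from `Y` by attaching a `k`-cell along `Φ : S^(k-1) → Y`,
with the quotient topology. -/
def AttachCell {k : ℕ} {Y : Type*} (Φ : USphere k → Y) : Type _ := Quot (GlueRel Φ)

instance {k : ℕ} {Y : Type*} [TopologicalSpace Y] (Φ : USphere k → Y) :
    TopologicalSpace (AttachCell Φ) :=
  inferInstanceAs (TopologicalSpace (Quot (GlueRel Φ)))

/-- The canonical map `Y → D^k ∪_Φ Y`. -/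
def AttachCell.incl {k : ℕ} {Y : Type*} (Φ : USphere k → Y) (y : Y) : AttachCell Φ :=
  Quot.mk _ (Sum.inr y)

end ThomJ

end

noncomputable section

namespace ThomJ

/-! ### Topology of the total space -/

/-! The sphere `S^n` is `D^n` with its boundary collapsed to the south pole, by `wrap`. The bundle
pulled back to `D^n` is trivial, and in the trivialization coming from the northern chart the map to
the total space is, over the boundary, `(x, v) ↦ f(x) v` into the single fibre over the south pole.

Compress `ℝ^q` to the open unit disc by `w ↦ w / (1 - ‖w‖)`. This gives a map `charCube` from `D^n ×
D^q` onto the Thom space. It is injective on the interior, with image the part of the total space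
off the south fibre. It sends `D^n × S^(q-1)` to `∞` and `S^(n-1) × D^q` to the compactified south
fibre `S^q` by the action of `f`. So its boundary restriction is literally the Hopf construction on
`f`, which represents `J(ρ)`.

Three facts carry the proof: the twisted map stays continuous at the boundary
(`continuous_toTotal`), the boundary values are those of `hopfFun` once the round ball is identified
with the product of discs (`charCube_cube_sphere`), and the glued map is bijective
(`cellMap_bijective`). A continuous bijection from a compact space to a Hausdorff one is a
homeomorphism. -/

theorem t2Space_totalSpace {B F : Type*} {E : B → Type*} [TopologicalSpace B] [T2Space B]
    [TopologicalSpace F] [T2Space F] [TopologicalSpace (TotalSpace F E)]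
    [∀ b, TopologicalSpace (E b)] [FiberBundle F E] : T2Space (TotalSpace F E) := by
  rw [t2Space_iff_disjoint_nhds]
  intro p p' hne
  have hπ : Continuous (π F E) := FiberBundle.continuous_proj F E
  by_cases hb : p.proj = p'.proj
  · set e := trivializationAt F E p.proj
    have hp : p ∈ e.source := FiberBundle.mem_trivializationAt_proj_source
    have hp' : p' ∈ e.source := by
      rw [e.mem_source, ← hb]
      exact FiberBundle.mem_baseSet_trivializationAt F E p.proj
    exact (e.continuousAt hp).disjoint
      (disjoint_nhds_nhds.mpr fun h => hne (e.injOn hp hp' h)) (e.continuousAt hp')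
  · exact (hπ.tendsto p).disjoint (disjoint_nhds_nhds.mpr hb) (hπ.tendsto p')

theorem locallyCompactSpace_totalSpace {B F : Type*} {E : B → Type*} [TopologicalSpace B]
    [LocallyCompactSpace B] [TopologicalSpace F] [LocallyCompactSpace F]
    [TopologicalSpace (TotalSpace F E)] [∀ b, TopologicalSpace (E b)] [FiberBundle F E] :
    LocallyCompactSpace (TotalSpace F E) :=
  ChartedSpace.locallyCompactSpace (B × F) (TotalSpace F E)

instance {B : Type*} [TopologicalSpace B] [T2Space B] [LocallyCompactSpace B] {k : ℕ} {ι : Type*}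
    (Z : VectorBundleCore ℝ B (Euc k) ι) : T2Space (Thom (Euc k) Z.Fiber) :=
  haveI : T2Space (TotalSpace (Euc k) Z.Fiber) := t2Space_totalSpace
  haveI : LocallyCompactSpace (TotalSpace (Euc k) Z.Fiber) := locallyCompactSpace_totalSpace
  inferInstance

/-- The norm of a vector in the clutched bundle, which carries an invariant metric. -/
def fibreNorm {n q : ℕ} (f : C(USphere n, SO q)) (p : TotalSpace (Euc q) (clutch f).Fiber) : ℝ :=
  ‖(show Euc q from p.snd)‖

/-- The preferred chart jumps at the south pole, but coordinate changes are rotations, so the norm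
can be read off in any fixed local trivialization. -/
theorem continuous_fibreNorm {n q : ℕ} (f : C(USphere n, SO q)) : Continuous (fibreNorm f) := by
  rw [continuous_iff_continuousAt]
  intro p
  set i := (clutch f).indexAt p.proj
  have hp : p ∈ ((clutch f).localTriv i).source := (clutch f).mem_baseSet_at p.proj
  refine (((clutch f).localTriv i).continuousAt hp).snd.norm.congr
    (Filter.Eventually.of_forall fun r => ?_)
  exact norm_act _ _

/-! ### Wrapping the disc around the sphere -/

theorem norm_sq_fstPart_add_height_sq {n : ℕ} (s : USphere (n + 1)) :
    ‖(fstPart s.1 : Euc n)‖ ^ 2 + height s ^ 2 = 1 := by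
  have h5 : ‖(sndPart s.1 : Euc 1)‖ ^ 2 = height s ^ 2 := by
    simp [EuclideanSpace.norm_sq_eq, sndPart, height]
    rfl
  rw [← h5, norm_sq_parts, mem_sphere_zero_iff_norm.mp s.2, one_pow]

theorem UBall.norm_le {k : ℕ} (x : UBall k) : ‖x.1‖ ≤ 1 := mem_closedBall_zero_iff.mp x.2

/-- The point of `ℝ^(n+1)` with given projections to `ℝ^n` and `ℝ`. -/
def snocVec {n : ℕ} (x : Euc n) (t : ℝ) : Euc (n + 1) :=
  WithLp.toLp 2 (Fin.snoc (α := fun _ => ℝ) x t)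

theorem fstPart_snocVec {n : ℕ} (x : Euc n) (t : ℝ) : fstPart (snocVec x t) = x := by
  ext i
  exact Fin.snoc_castSucc (α := fun _ => ℝ) t x i

theorem norm_sq_snocVec {n : ℕ} (x : Euc n) (t : ℝ) : ‖snocVec x t‖ ^ 2 = ‖x‖ ^ 2 + t ^ 2 := by
  simp [EuclideanSpace.norm_sq_eq, snocVec, Fin.sum_univ_castSucc]

/-- The map `D^n → S^n` that sends the centre to the north pole and `S^(n-1)` to the south pole. -/
def wrap {n : ℕ} (x : UBall n) : USphere (n + 1) :=
  -- With `‖x‖ = sin (θ/2)`, the double-angle formulas give horizontal length `sin θ` and height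
  -- `cos θ`.
  ⟨snocVec ((2 * √(1 - ‖x.1‖ ^ 2)) • x.1) (1 - 2 * ‖x.1‖ ^ 2), by
    rw [mem_sphere_zero_iff_norm, ← sq_eq_sq₀ (norm_nonneg _) zero_le_one, norm_sq_snocVec,
      norm_smul, Real.norm_of_nonneg (by positivity), mul_pow, mul_pow, Real.sq_sqrt]
    · ring
    · nlinarith [x.norm_le, norm_nonneg x.1]⟩

theorem fstPart_wrap {n : ℕ} (x : UBall n) :
    (fstPart (wrap x).1 : Euc n) = (2 * √(1 - ‖x.1‖ ^ 2)) • x.1 :=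
  fstPart_snocVec _ _

theorem height_wrap {n : ℕ} (x : UBall n) : height (wrap x) = 1 - 2 * ‖x.1‖ ^ 2 :=
  Fin.snoc_last (α := fun _ => ℝ) _ _

theorem continuous_wrap {n : ℕ} : Continuous (wrap : UBall n → USphere (n + 1)) := by
  refine Continuous.subtype_mk ((PiLp.continuous_toLp 2 _).comp (continuous_pi fun i => ?_)) _
  refine Fin.lastCases ?_ (fun j => ?_) i
  · simp only [Fin.snoc_last]
    fun_prop
  · simp only [Fin.snoc_castSucc]
    fun_prop

theorem eq_of_parts {n : ℕ} {s s' : USphere (n + 1)}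
    (h₁ : (fstPart s.1 : Euc n) = fstPart s'.1) (h₂ : height s = height s') : s = s' := by
  ext i
  refine Fin.lastCases h₂ (fun j => ?_) i
  exact congrArg (fun v : Euc n => v j) h₁

theorem height_wrap_ne {n : ℕ} {x : UBall n} (hx : ‖x.1‖ < 1) : height (wrap x) ≠ -1 := by
  rw [height_wrap]
  nlinarith [norm_nonneg x.1]

theorem wrap_of_norm_eq_one {n : ℕ} {x : UBall n} (hx : ¬‖x.1‖ < 1) : height (wrap x) = -1 := by
  rw [height_wrap, le_antisymm x.norm_le (not_lt.mp hx)]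
  norm_num

theorem eq_of_height_eq_neg_one {n : ℕ} {s s' : USphere (n + 1)} (h : height s = -1)
    (h' : height s' = -1) : s = s' := by
  refine eq_of_parts ?_ (h.trans h'.symm)
  have key : ∀ r : USphere (n + 1), height r = -1 → (fstPart r.1 : Euc n) = 0 := fun r hr => by
    have h₁ := norm_sq_fstPart_add_height_sq r
    rw [hr] at h₁
    exact norm_eq_zero.mp ((pow_eq_zero_iff two_ne_zero).mp (by linarith))
  rw [key s h, key s' h']

theorem sqrt_pos_of_norm_lt {n : ℕ} {x : Euc n} (hx : ‖x‖ < 1) : 0 < 2 * √(1 - ‖x‖ ^ 2) :=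
  mul_pos two_pos (Real.sqrt_pos.mpr (by nlinarith [norm_nonneg x]))

/-- The height determines the norm, and then the horizontal parts are the same nonzero multiple of
`x` and `y`. -/
theorem wrap_injective {n : ℕ} {x y : UBall n} (hx : ‖x.1‖ < 1) (h : wrap x = wrap y) : x = y := by
  have h₁ : ‖x.1‖ = ‖y.1‖ := by
    have := congrArg height h
    rw [height_wrap, height_wrap] at this
    exact (sq_eq_sq₀ (norm_nonneg _) (norm_nonneg _)).mp (by linarith)
  have h₂ := congrArg (fun s : USphere (n + 1) => (fstPart s.1 : Euc n)) h
  simp only [fstPart_wrap, ← h₁] at h₂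
  exact Subtype.ext (smul_right_injective _ (sqrt_pos_of_norm_lt hx).ne' h₂)

theorem exists_wrap_eq {n : ℕ} (s : USphere (n + 1)) (hs : height s ≠ -1) :
    ∃ x : UBall n, ‖x.1‖ < 1 ∧ wrap x = s := by
  have hsq := norm_sq_fstPart_add_height_sq s
  have h₁ : -1 < height s := lt_of_le_of_ne (by nlinarith [sq_nonneg ‖(fstPart s.1 : Euc n)‖]) hs.symm
  -- Solving `height s = 1 - 2‖x‖²` shows that `c` must be `√(1 - ‖x‖²)` at the preimage `x`, which
  -- is therefore the horizontal part divided by `2c`.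
  set c := √((1 + height s) / 2) with hc
  have hcpos : 0 < c := Real.sqrt_pos.mpr (by linarith)
  have hc2 : c ^ 2 = (1 + height s) / 2 := Real.sq_sqrt (by linarith)
  have hn : ‖(2 * c)⁻¹ • (fstPart s.1 : Euc n)‖ ^ 2 = (1 - height s) / 2 := by
    rw [norm_smul, Real.norm_of_nonneg (by positivity), mul_pow, inv_pow, mul_pow, hc2,
      inv_mul_eq_iff_eq_mul₀ (by linarith)]
    linear_combination hsq
  have hlt : ‖(2 * c)⁻¹ • (fstPart s.1 : Euc n)‖ < 1 := by
    rw [← sq_lt_one_iff₀ (norm_nonneg _), hn]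
    linarith
  refine ⟨⟨_, mem_closedBall_zero_iff.mpr hlt.le⟩, hlt, eq_of_parts ?_ ?_⟩
  · rw [fstPart_wrap]
    simp only [hn]
    rw [show 1 - (1 - height s) / 2 = (1 + height s) / 2 by ring, ← hc, smul_smul,
      mul_inv_cancel₀ (by positivity), one_smul]
  · rw [height_wrap]
    simp only [hn]
    ring

theorem direction_smul {k : ℕ} {c : ℝ} (hc : 0 < c) (x : Euc k) (hx : x ≠ 0) (h : c • x ≠ 0) :
    direction (c • x) h = direction x hx := by
  refine Subtype.ext ?_
  simp only [direction]
  rw [norm_smul, Real.norm_of_nonneg hc.le, smul_smul, mul_inv, mul_right_comm,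
    inv_mul_cancel₀ hc.ne', one_mul]

theorem meridian_wrap {n q : ℕ} (f : USphere n → SO q) {x : UBall n} (hx : ‖x.1‖ < 1)
    (h0 : x.1 ≠ 0) : meridian f (wrap x) = f (direction x.1 h0) := by
  have h : (2 * √(1 - ‖x.1‖ ^ 2)) • x.1 ≠ 0 := smul_ne_zero (sqrt_pos_of_norm_lt hx).ne' h0
  unfold meridian
  simp only [fstPart_wrap]
  rw [dif_pos h, direction_smul (sqrt_pos_of_norm_lt hx)]

/-! ### The characteristic map on `D^n × D^q` -/

theorem norm_direction_arg {n : ℕ} {x : UBall n} (hx : ¬‖x.1‖ < 1) : x.1 ≠ 0 := fun h => by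
  simp [h] at hx

/-- The clutching rotations on the boundary of `D^n`, and the identity in its interior. -/
def boundaryRotation {n q : ℕ} (f : USphere n → SO q) (x : UBall n) : SO q :=
  open Classical in
  if h : ‖x.1‖ < 1 then 1 else f (direction x.1 (norm_direction_arg h))

/-- The point of the total space over `s` with coordinates `v` in the preferred chart at `s`. -/
def vec {n q : ℕ} (f : C(USphere n, SO q)) (s : USphere (n + 1)) (v : Euc q) :
    TotalSpace (Euc q) (clutch f).Fiber :=
  ⟨s, v⟩

/-- The map `D^n × ℝ^q → E(ξ)` covering `wrap` that is the northern trivialization over the interior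
of `D^n` and is given by `(x, v) ↦ f(x) v` over its boundary. -/
def toTotal {n q : ℕ} (f : C(USphere n, SO q)) (x : UBall n) (v : Euc q) :
    TotalSpace (Euc q) (clutch f).Fiber :=
  vec f (wrap x) (act (boundaryRotation f x) v)

theorem fibreNorm_toTotal {n q : ℕ} (f : C(USphere n, SO q)) (x : UBall n) (v : Euc q) :
    fibreNorm f (toTotal f x v) = ‖v‖ :=
  norm_act _ _

theorem indexAt_of_ne {n q : ℕ} (f : C(USphere n, SO q)) {s : USphere (n + 1)}
    (h : height s ≠ -1) : (clutch f).indexAt s = true := if_pos h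

theorem indexAt_of_eq {n q : ℕ} (f : C(USphere n, SO q)) {s : USphere (n + 1)}
    (h : height s = -1) : (clutch f).indexAt s = false := if_neg (not_not.mpr h)

theorem localTriv_toTotal {n q : ℕ} (f : C(USphere n, SO q)) (i : Bool) (x : UBall n)
    (v : Euc q) : ((clutch f).localTriv i) (toTotal f x v) = (wrap x,
      act (transition f ((clutch f).indexAt (wrap x)) i (wrap x) * boundaryRotation f x) v) := by
  rw [act_mul]
  rfl

theorem localTriv_true_toTotal {n q : ℕ} (f : C(USphere n, SO q)) {x : UBall n} (hx : ‖x.1‖ < 1)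
    (v : Euc q) : ((clutch f).localTriv true) (toTotal f x v) = (wrap x, v) := by
  rw [localTriv_toTotal, indexAt_of_ne f (height_wrap_ne hx), boundaryRotation, dif_pos hx,
    transition, mul_one, act_one]
  · rfl
  all_goals simp

/-- The twist `boundaryRotation` is chosen for this formula. In the interior the factor `f` comes
from the chart transition and the twist is trivial; on the boundary the twist supplies `f` and the
chart is already the southern one. -/
theorem localTriv_false_toTotal {n q : ℕ} (f : C(USphere n, SO q)) {x : UBall n} (h0 : x.1 ≠ 0)
    (v : Euc q) : ((clutch f).localTriv false) (toTotal f x v) =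
      (wrap x, act (f (direction x.1 h0)) v) := by
  rw [localTriv_toTotal]
  by_cases hx : ‖x.1‖ < 1
  · rw [indexAt_of_ne f (height_wrap_ne hx), boundaryRotation, dif_pos hx, transition,
      meridian_wrap _ hx h0, mul_one]
  · rw [indexAt_of_eq f (wrap_of_norm_eq_one hx), boundaryRotation, dif_neg hx, transition,
      one_mul]
    all_goals simp

/-- Interior points are tested in the northern chart, boundary points in the southern one, whose
single formula holds for all `x ≠ 0` and hence on a neighbourhood of the boundary. -/
theorem continuous_toTotal {n q : ℕ} (f : C(USphere n, SO q)) :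
    Continuous fun p : UBall n × Euc q => toTotal f p.1 p.2 := by
  rw [continuous_iff_continuousAt]
  intro p
  have hw : Continuous fun p : UBall n × Euc q => wrap p.1 := continuous_wrap.comp continuous_fst
  have hx : Continuous fun p : UBall n × Euc q => p.1.1 := continuous_subtype_val.comp continuous_fst
  by_cases hp : ‖p.1.1‖ < 1
  · refine ((clutch f).localTriv true).continuousAt_of_comp_left hw.continuousAt
      (height_wrap_ne hp) ?_
    have hU : {r : UBall n × Euc q | ‖r.1.1‖ < 1} ∈ 𝓝 p :=
      (isOpen_lt hx.norm continuous_const).mem_nhds hp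
    refine (hw.prodMk continuous_snd).continuousAt.congr ?_
    filter_upwards [hU] with r hr
    exact (localTriv_true_toTotal f hr r.2).symm
  · have h0 : p.1.1 ≠ 0 := norm_direction_arg hp
    refine ((clutch f).localTriv false).continuousAt_of_comp_left hw.continuousAt ?_ ?_
    · change height (wrap p.1) ≠ 1
      rw [wrap_of_norm_eq_one hp]
      norm_num
    have hU : IsOpen {r : UBall n × Euc q | r.1.1 ≠ 0} := isOpen_ne_fun hx continuous_const
    refine ContinuousOn.continuousAt (s := {r : UBall n × Euc q | r.1.1 ≠ 0}) ?_ (hU.mem_nhds h0)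
    rw [continuousOn_iff_continuous_domRestrict]
    have hc : Continuous fun r : {r : UBall n × Euc q | r.1.1 ≠ 0} => r.1.1.1 :=
      hx.comp continuous_subtype_val
    have hd : Continuous fun r : {r : UBall n × Euc q | r.1.1 ≠ 0} => direction r.1.1.1 r.2 :=
      Continuous.subtype_mk ((hc.norm.inv₀ fun r => norm_ne_zero_iff.mpr r.2).smul hc) _
    refine ((hw.comp continuous_subtype_val).prodMk
      ((continuous_act.comp (f.continuous.comp hd)).clm_apply
        (continuous_snd.comp continuous_subtype_val))).congr fun r => ?_
    exact (localTriv_false_toTotal f r.2 r.1.2).symm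

/-- The characteristic map of the top cell, `D^n × D^q → Th(ξ)`. -/
def charCube {n q : ℕ} (f : C(USphere n, SO q)) (p : UBall n × UBall q) :
    Thom (Euc q) (clutch f).Fiber :=
  open Classical in
  if ‖p.2.1‖ < 1 then
    ((toTotal f p.1 ((1 - ‖p.2.1‖)⁻¹ • p.2.1) : TotalSpace (Euc q) (clutch f).Fiber) :
      OnePoint (TotalSpace (Euc q) (clutch f).Fiber))
  else OnePoint.infty

theorem continuous_charCube {n q : ℕ} (f : C(USphere n, SO q)) : Continuous (charCube f) := by
  rw [continuous_iff_continuousAt]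
  intro p
  have hb : Continuous fun p : UBall n × UBall q => p.2.1 := continuous_subtype_val.comp continuous_snd
  by_cases hp : ‖p.2.1‖ < 1
  · have hU : {r : UBall n × UBall q | ‖r.2.1‖ < 1} ∈ 𝓝 p :=
      (isOpen_lt hb.norm continuous_const).mem_nhds hp
    have hv : ContinuousAt (fun r : UBall n × UBall q => (1 - ‖r.2.1‖)⁻¹ • r.2.1) p :=
      ((continuous_const.sub hb.norm).continuousAt.inv₀ (sub_pos.mpr hp).ne').smul hb.continuousAt
    have hc : ContinuousAt
        (fun r : UBall n × UBall q => toTotal f r.1 ((1 - ‖r.2.1‖)⁻¹ • r.2.1)) p :=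
      ContinuousAt.comp (g := fun r : UBall n × Euc q => toTotal f r.1 r.2)
        (f := fun r : UBall n × UBall q => (r.1, (1 - ‖r.2.1‖)⁻¹ • r.2.1))
        (continuous_toTotal f).continuousAt (continuousAt_fst.prodMk hv)
    refine (OnePoint.continuous_coe.continuousAt.comp hc).congr ?_
    filter_upwards [hU] with r hr
    exact (if_pos hr).symm
  · have hval : charCube f p = OnePoint.infty := if_neg hp
    unfold ContinuousAt
    rw [hval, OnePoint.hasBasis_nhds_infty.tendsto_right_iff]
    rintro K ⟨-, hK⟩
    -- A compact set of vectors has fibre norm at most some `M`, while the image of `(x, w)` has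
    -- fibre norm `‖w‖ / (1 - ‖w‖)`. This exceeds `M` as soon as `M (1 - ‖w‖) < ‖w‖`, an open
    -- condition that holds at `‖w‖ = 1`.
    obtain ⟨M, hM⟩ := hK.exists_bound_of_continuousOn (continuous_fibreNorm f).continuousOn
    have hV : IsOpen {r : UBall n × UBall q | M * (1 - ‖r.2.1‖) < ‖r.2.1‖} :=
      isOpen_lt (continuous_const.mul (continuous_const.sub hb.norm)) hb.norm
    have hpV : M * (1 - ‖p.2.1‖) < ‖p.2.1‖ := by
      rw [le_antisymm p.2.norm_le (not_lt.mp hp)]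
      norm_num
    filter_upwards [hV.mem_nhds hpV] with r hr
    by_cases hr' : ‖r.2.1‖ < 1
    · refine Or.inl ⟨toTotal f r.1 ((1 - ‖r.2.1‖)⁻¹ • r.2.1), fun hmem => ?_, (if_pos hr').symm⟩
      have h6 := (le_abs_self _).trans (hM _ hmem)
      have hpos : 0 < 1 - ‖r.2.1‖ := sub_pos.mpr hr'
      rw [fibreNorm_toTotal, norm_smul, norm_inv, Real.norm_of_nonneg hpos.le,
        inv_mul_le_iff₀ hpos] at h6
      have h7 : M * (1 - ‖r.2.1‖) < ‖r.2.1‖ := hr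
      linarith [mul_comm M (1 - ‖r.2.1‖)]
    · exact Or.inr (if_neg hr')

/-! ### The fibre over the south pole -/

/-- The south pole of `S^n`. -/
def southPole (n : ℕ) : USphere (n + 1) :=
  ⟨snocVec 0 (-1), by
    rw [mem_sphere_zero_iff_norm, ← sq_eq_sq₀ (norm_nonneg _) zero_le_one, norm_sq_snocVec]
    norm_num⟩

theorem height_southPole (n : ℕ) : height (southPole n) = -1 :=
  Fin.snoc_last (α := fun _ => ℝ) _ _

/-- The inclusion of the fibre over the south pole. -/
def southFibre {n q : ℕ} (f : C(USphere n, SO q)) (v : Euc q) :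
    TotalSpace (Euc q) (clutch f).Fiber :=
  vec f (southPole n) v

theorem isClosedEmbedding_southFibre {n q : ℕ} (f : C(USphere n, SO q)) :
    IsClosedEmbedding (southFibre f) :=
  FiberBundle.totalSpaceMk_isClosedEmbedding (Euc q) (clutch f).Fiber (southPole n)

/-- The inclusion of the one-point compactification of the fibre over the south pole. -/
def southSphere {n q : ℕ} (f : C(USphere n, SO q)) : Sph q → Thom (Euc q) (clutch f).Fiber :=
  OnePoint.map (southFibre f)

/-- A closed embedding is proper, so it extends continuously to one-point compactifications. -/
theorem continuous_southSphere {n q : ℕ} (f : C(USphere n, SO q)) : Continuous (southSphere f) := by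
  have : T2Space (TotalSpace (Euc q) (clutch f).Fiber) := t2Space_totalSpace
  refine OnePoint.continuous_map (isClosedEmbedding_southFibre f).continuous ?_
  rw [Filter.coclosedCompact_eq_cocompact, Filter.coclosedCompact_eq_cocompact]
  exact (isClosedEmbedding_southFibre f).tendsto_cocompact

theorem southSphere_injective {n q : ℕ} (f : C(USphere n, SO q)) :
    Function.Injective (southSphere f) :=
  Option.map_injective (isClosedEmbedding_southFibre f).injective

/-! ### The radial identification of `D^(n+q)` with `D^n × D^q` -/

/-- The maximum of the norms of the two parts of a vector of `ℝ^(n+m)`. -/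
def maxNorm {n m : ℕ} (z : Euc (n + m)) : ℝ := max ‖(fstPart z : Euc n)‖ ‖(sndPart z : Euc m)‖

/-- The factor of the radial homeomorphism from the unit ball to the unit ball of `maxNorm`. -/
def radialFactor {n m : ℕ} (z : Euc (n + m)) : ℝ := ‖z‖ / maxNorm (n := n) (m := m) z

section

variable {n m : ℕ}

local notation "μ" => maxNorm (n := n) (m := m)

local notation "κ" => radialFactor (n := n) (m := m)

theorem maxNorm_nonneg (z : Euc (n + m)) : 0 ≤ μ z := le_max_of_le_left (norm_nonneg _)

theorem radialFactor_nonneg (z : Euc (n + m)) : 0 ≤ κ z :=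
  div_nonneg (norm_nonneg _) (maxNorm_nonneg z)

theorem maxNorm_smul {c : ℝ} (hc : 0 ≤ c) (z : Euc (n + m)) : μ (c • z) = c * μ z := by
  unfold maxNorm
  rw [mul_max_of_nonneg _ _ hc]
  have h : ∀ {k : ℕ} (v : Euc k), ‖c • v‖ = c * ‖v‖ := fun v => by
    rw [norm_smul, Real.norm_of_nonneg hc]
  exact congrArg₂ max (h (fstPart z)) (h (sndPart z))

theorem eq_zero_of_maxNorm_eq_zero {z : Euc (n + m)} (h : μ z = 0) : z = 0 := by
  have h₁ : ‖(fstPart z : Euc n)‖ = 0 := le_antisymm ((le_max_left _ _).trans h.le) (norm_nonneg _)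
  have h₂ : ‖(sndPart z : Euc m)‖ = 0 := le_antisymm ((le_max_right _ _).trans h.le) (norm_nonneg _)
  have h₃ := norm_sq_parts (n := n) (m := m) z
  rw [h₁, h₂] at h₃
  exact norm_eq_zero.mp ((pow_eq_zero_iff two_ne_zero).mp (by linarith))

theorem maxNorm_pos {z : Euc (n + m)} (h : z ≠ 0) : 0 < μ z :=
  (maxNorm_nonneg z).lt_of_ne fun h' => h (eq_zero_of_maxNorm_eq_zero h'.symm)

theorem radialFactor_mul_maxNorm (z : Euc (n + m)) : κ z * μ z = ‖z‖ := by
  by_cases h : z = 0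
  · simp [h, radialFactor]
  · exact div_mul_cancel₀ _ (maxNorm_pos h).ne'

theorem continuous_maxNorm : Continuous (maxNorm : Euc (n + m) → ℝ) :=
  continuous_fstPart.norm.max continuous_sndPart.norm

/-- The factor need not be continuous at the origin, where `0 / 0` makes it `0`; the product is
squeezed there by `κ z * μ z = ‖z‖`. -/
theorem continuous_radialFactor_smul {k : ℕ} {g : Euc (n + m) → Euc k} (hg : Continuous g)
    (hle : ∀ z, ‖g z‖ ≤ μ z) : Continuous fun z => κ z • g z := by
  rw [continuous_iff_continuousAt]
  intro z
  by_cases h : z = 0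
  · have hz : κ z • g z = 0 := by simp [h, radialFactor]
    change Filter.Tendsto _ _ (𝓝 (κ z • g z))
    rw [hz, tendsto_zero_iff_norm_tendsto_zero]
    have h0 : Filter.Tendsto (fun z : Euc (n + m) => ‖z‖) (𝓝 z) (𝓝 0) := by
      have := (continuous_norm (E := Euc (n + m))).tendsto z
      rwa [h, norm_zero, ← h] at this
    refine squeeze_zero (fun _ => norm_nonneg _) (fun y => ?_) h0
    rw [norm_smul, Real.norm_of_nonneg (radialFactor_nonneg y), ← radialFactor_mul_maxNorm y]
    exact mul_le_mul_of_nonneg_left (hle y) (radialFactor_nonneg y)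
  · exact (continuous_norm.continuousAt.div continuous_maxNorm.continuousAt
      (maxNorm_pos h).ne').smul hg.continuousAt

theorem norm_radialFactor_smul (z : Euc (n + m)) {k : ℕ} (v : Euc k) : ‖κ z • v‖ = κ z * ‖v‖ := by
  rw [norm_smul, Real.norm_of_nonneg (radialFactor_nonneg z)]

theorem norm_radialFactor_smul_le (z : UBall (n + m)) {k : ℕ} {v : Euc k} (hv : ‖v‖ ≤ μ z.1) :
    κ z.1 • v ∈ Metric.closedBall (0 : Euc k) 1 := by
  rw [mem_closedBall_zero_iff, norm_radialFactor_smul]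
  exact (mul_le_mul_of_nonneg_left hv (radialFactor_nonneg z.1)).trans
    ((radialFactor_mul_maxNorm z.1).trans_le z.norm_le)

end

/-- The radial map `D^(n+m) → D^n × D^m`. -/
def cube {n m : ℕ} (z : UBall (n + m)) : UBall n × UBall m :=
  (⟨radialFactor (n := n) (m := m) z.1 • fstPart z.1,
    norm_radialFactor_smul_le z (le_max_left _ _)⟩,
   ⟨radialFactor (n := n) (m := m) z.1 • sndPart z.1,
    norm_radialFactor_smul_le z (le_max_right _ _)⟩)

theorem continuous_cube {n m : ℕ} : Continuous (cube : UBall (n + m) → UBall n × UBall m) :=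
  (Continuous.subtype_mk ((continuous_radialFactor_smul continuous_fstPart
      fun _ => le_max_left _ _).comp continuous_subtype_val) _).prodMk
    (Continuous.subtype_mk ((continuous_radialFactor_smul continuous_sndPart
      fun _ => le_max_right _ _).comp continuous_subtype_val) _)

/-- The radial map turns the Euclidean norm into the maximum norm, so the open ball goes to the
product of open discs and the sphere to its boundary. -/
theorem max_norm_cube {n m : ℕ} (z : UBall (n + m)) :
    max ‖(cube (n := n) (m := m) z).1.1‖ ‖(cube (n := n) (m := m) z).2.1‖ = ‖z.1‖ := by
  simp only [cube, norm_radialFactor_smul]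
  rw [← mul_max_of_nonneg _ _ (radialFactor_nonneg z.1)]
  exact radialFactor_mul_maxNorm z.1

theorem ext_parts {n m : ℕ} {z z' : Euc (n + m)} (h₁ : (fstPart z : Euc n) = fstPart z')
    (h₂ : (sndPart z : Euc m) = sndPart z') : z = z' := by
  ext i
  refine Fin.addCases (fun j => ?_) (fun j => ?_) i
  · exact congrArg (fun v : Euc n => v j) h₁
  · exact congrArg (fun v : Euc m => v j) h₂

theorem cube_injective {n m : ℕ} :
    Function.Injective (cube : UBall (n + m) → UBall n × UBall m) := by
  intro z z' h
  have hr : ‖z.1‖ = ‖z'.1‖ := by rw [← max_norm_cube (n := n) (m := m), h, max_norm_cube]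
  set c := radialFactor (n := n) (m := m) z.1 with hc
  set c' := radialFactor (n := n) (m := m) z'.1 with hc'
  have hv : c • z.1 = c' • z'.1 := ext_parts
    (congrArg (fun p : UBall n × UBall m => p.1.1) h)
    (congrArg (fun p : UBall n × UBall m => p.2.1) h)
  by_cases h0 : z.1 = 0
  · rw [h0, norm_zero] at hr
    exact Subtype.ext (h0.trans (norm_eq_zero.mp hr.symm).symm)
  · have hcc : c = c' := by
      have := congrArg norm hv
      rw [norm_radialFactor_smul, norm_radialFactor_smul, ← hr] at this
      exact mul_right_cancel₀ (norm_ne_zero_iff.mpr h0) this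
    have hcpos : 0 < c := div_pos (norm_pos_iff.mpr h0) (maxNorm_pos h0)
    rw [← hcc] at hv
    exact Subtype.ext (smul_right_injective _ hcpos.ne' hv)

/-- The radial factor is unchanged by positive scaling, so scaling by its inverse `M / ‖y‖` gives a
preimage; at `y = 0` the value `0 / 0 = 0` does no harm. -/
theorem cube_surjective {n m : ℕ} :
    Function.Surjective (cube : UBall (n + m) → UBall n × UBall m) := by
  rintro ⟨x, w⟩
  set y : Euc (n + m) := WithLp.toLp 2 (Fin.append x.1 w.1) with hy
  have hfst : (fstPart y : Euc n) = x.1 := by ext i; simp [fstPart, hy]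
  have hsnd : (sndPart y : Euc m) = w.1 := by ext i; simp [sndPart, hy]
  set M := maxNorm (n := n) (m := m) y with hM
  have hM0 : 0 ≤ M := maxNorm_nonneg y
  have hM1 : M ≤ 1 := by
    rw [hM, maxNorm, hfst, hsnd]
    exact max_le x.norm_le w.norm_le
  have hd : 0 ≤ M / ‖y‖ := div_nonneg hM0 (norm_nonneg _)
  have hz : ‖(M / ‖y‖) • y‖ ≤ 1 := by
    rw [norm_smul, Real.norm_of_nonneg hd]
    rcases eq_or_ne ‖y‖ 0 with h0 | h0
    · rw [h0, mul_zero]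
      exact zero_le_one
    · rwa [div_mul_cancel₀ _ h0]
  have key : radialFactor (n := n) (m := m) ((M / ‖y‖) • y) • (M / ‖y‖) • y = y := by
    by_cases h0 : y = 0
    · simp [h0]
    · have hMpos : 0 < M := maxNorm_pos h0
      have hypos : 0 < ‖y‖ := norm_pos_iff.mpr h0
      rw [radialFactor, maxNorm_smul hd, norm_smul, Real.norm_of_nonneg hd, ← hM, smul_smul]
      convert one_smul ℝ y using 2
      field_simp
  refine ⟨⟨(M / ‖y‖) • y, mem_closedBall_zero_iff.mpr hz⟩, Prod.ext (Subtype.ext ?_) (Subtype.ext ?_)⟩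
  · exact (congrArg (fstPart (n := n) (m := m)) key).trans hfst
  · exact (congrArg (sndPart (n := n) (m := m)) key).trans hsnd

/-! ### The cell structure of the Thom space -/

/-- Write `z = (a, b)`, so that `c * max ‖a‖ ‖b‖ = 1`. If `‖b‖ < ‖a‖`, then `x = c • a` is a unit
vector: it wraps to the south pole and the twist is `f (a / ‖a‖)`. Otherwise `w = c • b` is a unit
vector, and both sides are `∞`. -/
theorem charCube_cube_sphere {n q : ℕ} (f : C(USphere n, SO q)) (z : USphere (n + q)) :
    charCube f (cube ⟨z.1, Metric.sphere_subset_closedBall z.2⟩) =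
      southSphere f (hopfFun f z) := by
  have hz : ‖z.1‖ = 1 := mem_sphere_zero_iff_norm.mp z.2
  set a : Euc n := fstPart z.1 with ha
  set b : Euc q := sndPart z.1 with hb
  set c := radialFactor (n := n) (m := q) z.1 with hc
  have hW : ‖(cube (n := n) (m := q) ⟨z.1, Metric.sphere_subset_closedBall z.2⟩).2.1‖ = c * ‖b‖ :=
    norm_radialFactor_smul _ _
  have hX : ‖(cube (n := n) (m := q) ⟨z.1, Metric.sphere_subset_closedBall z.2⟩).1.1‖ = c * ‖a‖ :=
    norm_radialFactor_smul _ _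
  have hcm : c * max ‖a‖ ‖b‖ = 1 := (radialFactor_mul_maxNorm z.1).trans hz
  have hcpos : 0 < c := (radialFactor_nonneg z.1).lt_of_ne fun h => by
    rw [hc, ← h, zero_mul] at hcm
    exact zero_ne_one hcm
  by_cases h : ‖b‖ < ‖a‖
  · rw [max_eq_left h.le] at hcm
    have hw : c * ‖b‖ < 1 := by
      rw [← hcm]
      exact mul_lt_mul_of_pos_left h hcpos
    have hx : ¬‖(cube (n := n) (m := q) ⟨z.1, Metric.sphere_subset_closedBall z.2⟩).1.1‖ < 1 := by
      rw [hX, hcm]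
      exact lt_irrefl 1
    have ha0 : a ≠ 0 := norm_pos_iff.mp ((norm_nonneg _).trans_lt h)
    rw [hopfFun, dif_pos h, charCube, if_pos (hW.trans_lt hw), hW]
    refine congrArg OnePoint.some ?_
    refine congrArg₂ (vec f) (eq_of_height_eq_neg_one (wrap_of_norm_eq_one hx)
      (height_southPole n)) ?_
    rw [boundaryRotation, dif_neg hx]
    have hdir : direction (cube (n := n) (m := q)
        ⟨z.1, Metric.sphere_subset_closedBall z.2⟩).1.1 (norm_direction_arg hx) =
        direction a ha0 := direction_smul hcpos a ha0 _
    rw [hdir]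
    congr 1
    change (1 - c * ‖b‖)⁻¹ • c • b = (‖a‖ - ‖b‖)⁻¹ • b
    -- Replacing `1` by `c * ‖a‖` makes `c` cancel.
    rw [smul_smul, ← hcm, ← mul_sub, mul_inv, mul_right_comm, inv_mul_cancel₀ hcpos.ne', one_mul]
  · rw [max_eq_right (not_lt.mp h)] at hcm
    rw [hopfFun, dif_neg h, charCube, if_neg (by rw [hW, hcm]; exact lt_irrefl 1)]
    rfl

/-- The map `D^(n+q) ∪ S^q → Th(ξ)` given by the characteristic map of the top cell and the
compactified fibre over the south pole. -/
def cellMap {n q : ℕ} (f : C(USphere n, SO q)) :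
    AttachCell (hopfFun (f : USphere n → SO q)) → Thom (Euc q) (clutch f).Fiber :=
  Quot.lift (Sum.elim (fun z => charCube f (cube z)) (southSphere f)) (by
    rintro _ _ ⟨z⟩
    exact charCube_cube_sphere f z)

theorem continuous_cellMap {n q : ℕ} (f : C(USphere n, SO q)) : Continuous (cellMap f) :=
  continuous_quot_lift _
    (((continuous_charCube f).comp continuous_cube).sumElim (continuous_southSphere f))

/-- Boundary points of the disc are glued into `Y`, so injectivity can be checked on `Y` and the
open cell. -/
theorem attachCell_cases {k : ℕ} {Y : Type*} (Φ : USphere k → Y) (p : AttachCell Φ) :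
    (∃ y, p = AttachCell.incl Φ y) ∨ ∃ z : UBall k, ‖z.1‖ < 1 ∧ p = Quot.mk _ (Sum.inl z) := by
  rcases p with ⟨z | y⟩
  · by_cases hz : ‖z.1‖ < 1
    · exact Or.inr ⟨z, hz, rfl⟩
    · exact Or.inl ⟨_, Quot.sound (GlueRel.glue ⟨z.1,
        mem_sphere_zero_iff_norm.mpr (le_antisymm z.norm_le (not_lt.mp hz))⟩)⟩
  · exact Or.inl ⟨y, rfl⟩

theorem charCube_of_lt {n q : ℕ} (f : C(USphere n, SO q)) {p : UBall n × UBall q}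
    (h₁ : ‖p.1.1‖ < 1) (h₂ : ‖p.2.1‖ < 1) :
    charCube f p = (vec f (wrap p.1) ((1 - ‖p.2.1‖)⁻¹ • p.2.1) :
      OnePoint (TotalSpace (Euc q) (clutch f).Fiber)) := by
  rw [charCube, if_pos h₂, toTotal, boundaryRotation, dif_pos h₁, act_one]
  rfl

/-- The open cell lies over the complement of the south pole and misses `∞`. -/
theorem charCube_ne_southSphere {n q : ℕ} (f : C(USphere n, SO q)) {p : UBall n × UBall q}
    (h₁ : ‖p.1.1‖ < 1) (h₂ : ‖p.2.1‖ < 1) (y : Sph q) : charCube f p ≠ southSphere f y := by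
  rw [charCube_of_lt f h₁ h₂]
  induction y using OnePoint.rec with
  | infty => exact OnePoint.coe_ne_infty _
  | coe v =>
    intro h
    have := congrArg TotalSpace.proj (OnePoint.coe_injective h)
    exact height_wrap_ne h₁ ((congrArg height this).trans (height_southPole n))

theorem expand_left_inverse {k : ℕ} {w : Euc k} (hw : ‖w‖ < 1) :
    (1 + ‖(1 - ‖w‖)⁻¹ • w‖)⁻¹ • (1 - ‖w‖)⁻¹ • w = w := by
  have hpos : 0 < 1 - ‖w‖ := sub_pos.mpr hw
  rw [norm_smul, norm_inv, Real.norm_of_nonneg hpos.le, smul_smul]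
  convert one_smul ℝ w using 2
  field_simp
  ring

theorem exists_expand_eq {k : ℕ} (v : Euc k) :
    ∃ w : UBall k, ‖w.1‖ < 1 ∧ (1 - ‖w.1‖)⁻¹ • w.1 = v := by
  have hpos : 0 < 1 + ‖v‖ := by positivity
  have hn : ‖(1 + ‖v‖)⁻¹ • v‖ = (1 + ‖v‖)⁻¹ * ‖v‖ := by
    rw [norm_smul, norm_inv, Real.norm_of_nonneg hpos.le]
  have hlt : ‖(1 + ‖v‖)⁻¹ • v‖ < 1 := by
    rw [hn, inv_mul_lt_iff₀ hpos]
    linarith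
  refine ⟨⟨_, mem_closedBall_zero_iff.mpr hlt.le⟩, hlt, ?_⟩
  have h1 : 1 - (1 + ‖v‖)⁻¹ * ‖v‖ = (1 + ‖v‖)⁻¹ := by
    field_simp
    ring
  change (1 - ‖(1 + ‖v‖)⁻¹ • v‖)⁻¹ • (1 + ‖v‖)⁻¹ • v = v
  rw [hn, h1, smul_smul, inv_mul_cancel₀ (inv_ne_zero hpos.ne'), one_smul]

theorem charCube_injOn {n q : ℕ} (f : C(USphere n, SO q)) :
    Set.InjOn (charCube f) {p | ‖p.1.1‖ < 1 ∧ ‖p.2.1‖ < 1} := by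
  rintro p ⟨hp₁, hp₂⟩ p' ⟨hp₁', hp₂'⟩ h
  rw [charCube_of_lt f hp₁ hp₂, charCube_of_lt f hp₁' hp₂'] at h
  have h' := OnePoint.coe_injective h
  have hv : (1 - ‖p.2.1‖)⁻¹ • p.2.1 = (1 - ‖p'.2.1‖)⁻¹ • p'.2.1 :=
    congrArg (fun r : TotalSpace (Euc q) (clutch f).Fiber => (show Euc q from r.snd)) h'
  refine Prod.ext (wrap_injective hp₁ (congrArg TotalSpace.proj h')) (Subtype.ext ?_)
  rw [← expand_left_inverse hp₂, hv, expand_left_inverse hp₂']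

theorem cube_lt {n m : ℕ} {z : UBall (n + m)} (hz : ‖z.1‖ < 1) :
    ‖(cube (n := n) (m := m) z).1.1‖ < 1 ∧ ‖(cube (n := n) (m := m) z).2.1‖ < 1 :=
  max_lt_iff.mp ((max_norm_cube z).trans_lt hz)

theorem cellMap_bijective {n q : ℕ} (f : C(USphere n, SO q)) : Function.Bijective (cellMap f) := by
  constructor
  · intro p p' h
    obtain ⟨y, rfl⟩ | ⟨z, hz, rfl⟩ := attachCell_cases _ p <;>
      obtain ⟨y', rfl⟩ | ⟨z', hz', rfl⟩ := attachCell_cases _ p'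
    · exact congrArg _ (southSphere_injective f h)
    · exact absurd h.symm (charCube_ne_southSphere f (cube_lt hz').1 (cube_lt hz').2 y)
    · exact absurd h (charCube_ne_southSphere f (cube_lt hz).1 (cube_lt hz).2 y')
    · rw [cube_injective (charCube_injOn f (cube_lt hz) (cube_lt hz') h)]
  · intro p
    induction p using OnePoint.rec with
    | infty => exact ⟨AttachCell.incl _ OnePoint.infty, rfl⟩
    | coe p =>
      obtain ⟨s, v, rfl⟩ : ∃ (s : USphere (n + 1)) (v : Euc q), p = vec f s v :=
        ⟨p.proj, p.snd, rfl⟩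
      -- Vectors over the south pole come from `S^q`, all others from the open cell.
      by_cases hs : height s = -1
      · obtain rfl : s = southPole n := eq_of_height_eq_neg_one hs (height_southPole n)
        exact ⟨AttachCell.incl _ (v : OnePoint (Euc q)), rfl⟩
      · obtain ⟨x, hx, rfl⟩ := exists_wrap_eq s hs
        obtain ⟨w, hw, rfl⟩ := exists_expand_eq v
        obtain ⟨z, hz⟩ := cube_surjective (x, w)
        refine ⟨Quot.mk _ (Sum.inl z), ?_⟩
        change charCube f (cube z) = _
        rw [hz, charCube_of_lt f (p := (x, w)) hx hw]

instance {k : ℕ} {Y : Type*} [TopologicalSpace Y] [CompactSpace Y] (Φ : USphere k → Y) :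
    CompactSpace (AttachCell Φ) :=
  haveI : CompactSpace (UBall k) := isCompact_iff_compactSpace.mp (isCompact_closedBall _ _)
  inferInstanceAs (CompactSpace (Quot (GlueRel Φ)))

/-- The Thom space of the clutched bundle is `S^q` with an `(n+q)`-cell attached along the Hopf
construction on the clutching map. -/
def thomClutchHomeo {n q : ℕ} (f : C(USphere n, SO q)) :
    Thom (Euc q) (clutch f).Fiber ≃ₜ AttachCell (hopfFun (f : USphere n → SO q)) :=
  (Continuous.homeoOfEquivCompactToT2 (f := Equiv.ofBijective _ (cellMap_bijective f))
    (continuous_cellMap f)).symm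

theorem thomClutchHomeo_infty {n q : ℕ} (f : C(USphere n, SO q)) :
    thomClutchHomeo f OnePoint.infty = AttachCell.incl _ OnePoint.infty := by
  rw [thomClutchHomeo, Homeomorph.symm_apply_eq]
  rfl

end ThomJ

end

theorem mainTheorem9 (n q : ℕ) (hn : 2 ≤ n) (hq : 1 ≤ q)
    (x₀ : ThomJ.USphere n) (y₀ : ThomJ.USphere q)
    (ρ : ThomJ.PClass x₀ (1 : ThomJ.SO q))
    (ξ : ThomJ.USphere (n + 1) → Type*)
    [∀ s, AddCommGroup (ξ s)] [∀ s, Module ℝ (ξ s)] [∀ s, TopologicalSpace (ξ s)]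
    [TopologicalSpace (Bundle.TotalSpace (ThomJ.Euc q) ξ)]
    [FiberBundle (ThomJ.Euc q) ξ] [VectorBundle ℝ (ThomJ.Euc q) ξ]
    (hξ : ThomJ.Corresponds ρ ξ) :
    ∃ Φ : ThomJ.PMap (ThomJ.inclSnd n y₀) (OnePoint.infty : ThomJ.Sph q),
      Φ.cls = ThomJ.J y₀ ρ ∧
      ∃ h : ThomJ.Thom (ThomJ.Euc q) ξ ≃ₜ ThomJ.AttachCell Φ.1,
        h OnePoint.infty = ThomJ.AttachCell.incl Φ.1 OnePoint.infty := by
  obtain ⟨f, rfl, ⟨e⟩⟩ := hξ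
  -- `J` is defined on representatives by `hopfMap`, so the class is right by definition. The
  -- homeomorphism of total spaces extends to the Thom spaces, fixing `∞`.
  exact ⟨ThomJ.hopfMap y₀ f, rfl, e.total.onePointCongr.trans (ThomJ.thomClutchHomeo f.1),
    ThomJ.thomClutchHomeo_infty f.1⟩
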